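/- An overpartition of a non-negative integer $m$ is a partition of $m$ in which the first occurrence of each part (that is, one copy of each distinct part size) may or may not be overlined. An overpartition triple of a non-negative integer $m$ is an ordered triple $(\omega_1,\omega_2,\omega_3)$ of overpartitions (each possibly empty) such that the sum of all the parts of $\omega_1,\omega_2,\omega_3$ is $m$. Let $\overline{p}_3(m)$ denote the number of overpartition triples of $m$ (so $\overline{p}_3(0)=1$). Then for any integers $\alpha\ge 1$ and $n\ge 0$, $$\overline{p}_3\big(3^{2\alpha+1}(3n+2)\big)\equiv 0 \pmod{144}.$$ -/

import Mathlib

/-- An overpartition of `n`: a partition of `n` in which the first occurrence of each part may be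
overlined. It is recorded as a partition of `n` together with the set of those part sizes whose
first occurrence is overlined. -/
@[ext]
structure Overpartition (n : ℕ) where
  /-- the underlying partition of `n` -/
  toPartition : n.Partition
  /-- the part sizes whose first occurrence is overlined -/
  overlined : Finset ℕ
  /-- only parts that occur can be overlined -/
  overlined_subset : overlined ⊆ toPartition.parts.toFinset

/-- An overpartition `k`-tuple of `n`: a `k`-tuple `(ω₁, …, ω_k)` of overpartitions (of arbitrary
natural numbers) such that the sum of all the parts of all the `ω_i` is `n`. -/
def OverpartitionTuple (k n : ℕ) : Type :=
  {ω : Fin k → (Σ m : ℕ, Overpartition m) // ∑ i, (ω i).2.toPartition.parts.sum = n}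

instance Overpartition.instFinite (n : ℕ) : Finite (Overpartition n) := by
  let f : Overpartition n → Σ p : n.Partition, {s // s ∈ p.parts.toFinset.powerset} :=
    fun o => ⟨o.toPartition, o.overlined, Finset.mem_powerset.2 o.overlined_subset⟩
  refine Finite.of_injective f ?_
  rintro ⟨p, s, hs⟩ ⟨p', s', hs'⟩ h
  simp only [f, Sigma.mk.injEq] at h
  obtain ⟨rfl, h⟩ := h
  simpa using h

/-- There are only finitely many overpartition `k`-tuples of `n`. -/
instance OverpartitionTuple.instFinite (k n : ℕ) : Finite (OverpartitionTuple k n) := by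
  have hle : ∀ (ω : OverpartitionTuple k n) (i : Fin k), (ω.1 i).1 < n + 1 := by
    intro ω i
    have h1 := Finset.single_le_sum
      (f := fun i => (ω.1 i).2.toPartition.parts.sum) (fun _ _ => Nat.zero_le _)
      (Finset.mem_univ i)
    rw [ω.2] at h1
    simp only [Nat.Partition.parts_sum] at h1
    omega
  let g : (Fin k → Σ m : Fin (n + 1), Overpartition m) → (Fin k → Σ m : ℕ, Overpartition m) :=
    fun t i => ⟨(t i).1, (t i).2⟩
  have hsub : {ω : Fin k → (Σ m : ℕ, Overpartition m) |
      ∑ i, (ω i).2.toPartition.parts.sum = n} ⊆ Set.range g := by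
    intro ω hω
    exact ⟨fun i => ⟨⟨(ω i).1, hle ⟨ω, hω⟩ i⟩, (ω i).2⟩, rfl⟩
  exact ((Set.finite_range g).subset hsub).to_subtype

/-- The number `p̄_k(n)` of overpartition `k`-tuples of `n`. For `n = 0` it is `1`, the only
overpartition of `0` being the empty one. -/
noncomputable def overpartitionTupleCount (k n : ℕ) : ℕ :=
  Nat.card (OverpartitionTuple k n)

/-! By Gauss's identity the overpartition series is `h = 1/f`, with `f = ∑ (-1)^n q^(n^2)`, so the
count is a coefficient of `h^3`; moduli 16 and 9 are treated separately.

Modulo 16, `f = 1 + 2S` makes `h^3` congruent to `1 - 6S(q) + 8S(q^2)`, supported on 0, squares and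
doubled squares; an odd power of 3 times `3n+2` is none of these.

Modulo 9, write `E` for `q ↦ q^3`. Squares mod 3 give `f = E(E f) - 2q E(w)`, and the norm over cube
roots of unity (`thetaSeries_pow_four`) turns this into a dissection of `h`. Keeping only exponents
divisible by 3 sends `h^3` to `E f * h^4`, then to `E f * f^2`, then to `f * (E f)^2`; after that
the last two alternate. An odd number (at least 3) of extractions ends at `f * (E f)^2`, which has
no exponents `3n+2`. -/

open PowerSeries Finset Filter Topology
open scoped PowerSeries.WithPiTopology

/-! ### Gauss's identity -/

/-- Finite form of Gauss's identity for `∑ (-1)^j q^(j^2)`, where `r i` inverts `1 + q^i`. -/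
theorem sum_neg_one_pow_mul_pow_sq_eq {A : Type*} [CommRing A] (q : A) (r : ℕ → A)
    (hr : ∀ i, r i * (1 + q ^ i) = 1) (n : ℕ) :
    1 + ∑ j ∈ range n, 2 * (-1) ^ (j + 1) * q ^ ((j + 1) ^ 2) =
      ∑ s ∈ range (n + 1), 2 * (-1) ^ s * r s * q ^ (s * (n + 1)) *
        ∏ i ∈ Ioc s n, (1 - q ^ i) * r i := by
  have h0 : r 0 * 2 = 1 := by have := hr 0; rw [pow_zero] at this; linear_combination this
  induction n with
  | zero => simp; linear_combination -h0
  | succ n ih =>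
    have hP : ∀ s ≤ n, ∏ i ∈ Ioc s (n + 1), (1 - q ^ i) * r i =
        (∏ i ∈ Ioc s n, (1 - q ^ i) * r i) * ((1 - q ^ (n + 1)) * r (n + 1)) := fun s hs =>
      prod_Ioc_succ_top (by omega) _
    -- Telescoping: the sums for `n + 1` and `n`, cut at the same `k`, differ by one term. At `k =
    -- n` it combines with the term `s = n + 1` into the new theta term.
    have key : ∀ k ≤ n, ∑ s ∈ range (k + 1), 2 * (-1) ^ s * r s * q ^ (s * (n + 1 + 1)) *
          ∏ i ∈ Ioc s (n + 1), (1 - q ^ i) * r i =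
        ∑ s ∈ range (k + 1), 2 * (-1) ^ s * r s * q ^ (s * (n + 1)) *
          (∏ i ∈ Ioc s n, (1 - q ^ i) * r i) -
        2 * (-1) ^ k * q ^ ((k + 1) * (n + 1)) * r (n + 1) *
          ∏ i ∈ Ioc k n, (1 - q ^ i) * r i := by
      intro k hk
      induction k with
      | zero =>
        rw [sum_range_one, sum_range_one, hP 0 hk]
        have h1 := hr (n + 1)
        simp only [zero_mul, pow_zero, zero_add, one_mul, mul_one]
        linear_combination (∏ i ∈ Ioc 0 n, (1 - q ^ i) * r i) *
          (h1 + ((1 - q ^ (n + 1)) * r (n + 1) - 1) * h0)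
      | succ k ih =>
        rw [sum_range_succ, ih (by omega), sum_range_succ _ (k + 1), hP _ hk,
          ← prod_Ioc_consecutive _ (Nat.le_succ k) hk, Nat.Ioc_succ_singleton, prod_singleton]
        have h1 := hr (n + 1)
        have h2 := hr (k + 1)
        set p := ∏ i ∈ Ioc (k + 1) n, (1 - q ^ i) * r i
        have e1 : q ^ ((k + 1) * (n + 1 + 1)) = q ^ ((k + 1) * (n + 1)) * q ^ (k + 1) := by ring
        have e2 : q ^ ((k + 1 + 1) * (n + 1)) = q ^ ((k + 1) * (n + 1)) * q ^ (n + 1) := by ring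
        rw [e1, e2, pow_succ (-1 : A) k]
        linear_combination (-(2 * (-1) ^ k * p * q ^ ((k + 1) * (n + 1)))) *
          (r (k + 1) * h1 - q ^ (n + 1) * r (n + 1) * h2)
    rw [sum_range_succ, ← add_assoc, ih, sum_range_succ _ (n + 1), key n le_rfl]
    have h1 := hr (n + 1)
    simp only [Ioc_self, prod_empty, mul_one]
    have e1 : q ^ ((n + 1) * (n + 1 + 1)) = q ^ ((n + 1) ^ 2) * q ^ (n + 1) := by ring
    have e2 : q ^ ((n + 1) * (n + 1)) = q ^ ((n + 1) ^ 2) := by ring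
    rw [e1, e2, pow_succ (-1 : A) n]
    linear_combination 2 * (-1) ^ n * q ^ ((n + 1) ^ 2) * h1

/-- The theta series `∑ (-1)^n X^(n^2)` over all integers `n`. -/
noncomputable def thetaSeries : ℤ⟦X⟧ :=
  PowerSeries.mk fun m => if m = 0 then 1 else if IsSquare m then 2 * (-1) ^ m else 0

/-- Partial products of `∏ (1 - X^i) / (1 + X^i)`. -/
noncomputable def thetaProd (n : ℕ) : ℂ⟦X⟧ :=
  ∏ i ∈ range n, (1 - X ^ (i + 1)) * (1 + X ^ (i + 1))⁻¹

lemma one_add_X_pow_mul_inv (i : ℕ) : (1 + X ^ i : ℂ⟦X⟧)⁻¹ * (1 + X ^ i) = 1 := by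
  apply PowerSeries.inv_mul_cancel
  rcases i with _ | i
  · simp
  · simp

lemma coeff_thetaProd {n m : ℕ} (h : m ≤ n) :
    coeff m (thetaProd n) = ((coeff m thetaSeries : ℤ) : ℂ) := by
  have key := sum_neg_one_pow_mul_pow_sq_eq (X : ℂ⟦X⟧) (fun i => (1 + X ^ i)⁻¹)
    one_add_X_pow_mul_inv n
  rw [sum_range_succ'] at key
  have h0 := one_add_X_pow_mul_inv 0
  have hP : ∏ i ∈ Ioc 0 n, (1 - X ^ i) * (1 + X ^ i : ℂ⟦X⟧)⁻¹ = thetaProd n := by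
    clear key h
    induction n with
    | zero => simp [thetaProd]
    | succ n ih => rw [prod_Ioc_succ_top (Nat.zero_le n), ih, thetaProd, thetaProd, prod_range_succ]
  -- The term `s = 0` is the product itself, as `r 0 = 1/2`; all others carry `X ^ (n + 1)` and are
  -- invisible up to degree `n`.
  have e : thetaProd n = 1 + ∑ j ∈ range n, 2 * (-1) ^ (j + 1) * (X : ℂ⟦X⟧) ^ ((j + 1) ^ 2) -
      X ^ (n + 1) * ∑ s ∈ range n, 2 * (-1) ^ (s + 1) * (1 + X ^ (s + 1))⁻¹ *
        X ^ (s * (n + 1)) * ∏ i ∈ Ioc (s + 1) n, (1 - X ^ i) * (1 + X ^ i)⁻¹ := by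
    rw [key, hP, mul_sum]
    have : ∀ s, (X : ℂ⟦X⟧) ^ ((s + 1) * (n + 1)) = X ^ (n + 1) * X ^ (s * (n + 1)) := by
      intro s; ring
    simp only [this, zero_mul, pow_zero, mul_one]
    rw [pow_zero] at h0
    have h1 : ∀ a b c d e : ℂ⟦X⟧, a * b * (c * d) * e = c * (a * b * d * e) := by intros; ring
    simp only [h1]
    linear_combination -thetaProd n * h0
  have h2 : ∀ j : ℕ, (2 * (-1) ^ (j + 1) : ℂ⟦X⟧) = C (2 * (-1) ^ (j + 1)) := by
    intro j; simp [map_ofNat]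
  rw [e, map_sub, coeff_X_pow_mul', if_neg (by omega), sub_zero, map_add, map_sum]
  simp only [h2, coeff_C_mul, coeff_X_pow, thetaSeries, coeff_mk, coeff_one]
  rcases Nat.eq_zero_or_pos m with rfl | hm
  · simp only [if_true, Int.cast_one, add_eq_left]
    exact sum_eq_zero fun j _ => by rw [if_neg (by positivity), mul_zero]
  · rw [if_neg hm.ne', if_neg hm.ne', zero_add]
    split_ifs with hs
    · obtain ⟨k, rfl⟩ := hs
      have hk : 0 < k := Nat.pos_of_mul_pos_left hm
      rw [sum_eq_single (k - 1)]
      · rw [Nat.sub_add_cancel hk, if_pos (by ring)]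
        rcases Nat.even_or_odd k with h | h
        · simp [h.neg_one_pow, (h.mul_right k).neg_one_pow]
        · simp [h.neg_one_pow, (h.mul h).neg_one_pow]
      · intro j _ hj
        rw [if_neg, mul_zero]
        intro h'
        have : k = j + 1 := by nlinarith
        omega
      · intro hk'
        have := Nat.le_mul_self k
        exact absurd (mem_range.2 (by omega)) hk'
    · rw [sum_eq_zero]
      · simp
      · intro j _
        rw [if_neg, mul_zero]
        rintro rfl
        exact hs ⟨j + 1, by ring⟩

/-- **Gauss's identity**: `∑ (-1)^n X^(n^2) = ∏ (1 - X^i) / (1 + X^i)`. -/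
theorem tendsto_thetaProd :
    Tendsto thetaProd atTop (𝓝 (PowerSeries.map (Int.castRingHom ℂ) thetaSeries)) := by
  rw [PowerSeries.WithPiTopology.tendsto_iff_coeff_tendsto]
  intro d
  refine tendsto_const_nhds.congr' ?_
  filter_upwards [eventually_ge_atTop d] with n hn
  rw [coeff_thetaProd hn]
  simp

/-! ### Generating functions of overpartitions and their tuples -/

/-- An overpartition is a partition with a subset of its set of part sizes. -/
def Overpartition.equivSigma (n : ℕ) :
    Overpartition n ≃ Σ p : n.Partition, {s // s ∈ p.parts.toFinset.powerset} where
  toFun o := ⟨o.toPartition, o.overlined, mem_powerset.2 o.overlined_subset⟩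
  invFun x := ⟨x.1, x.2.1, mem_powerset.1 x.2.2⟩
  left_inv _ := rfl
  right_inv _ := rfl

/-- The generating function of overpartitions. -/
noncomputable def overpartitionSeries : ℤ⟦X⟧ :=
  PowerSeries.mk fun n => (Nat.card (Overpartition n) : ℤ)

/-- Each distinct part size is overlined or not, hence weighs 2. -/
lemma map_overpartitionSeries : PowerSeries.map (Int.castRingHom ℂ) overpartitionSeries =
    Nat.Partition.genFun fun _ _ => (2 : ℂ) := by
  ext n
  rw [coeff_map, overpartitionSeries, coeff_mk, Nat.Partition.coeff_genFun,
    Nat.card_congr (Overpartition.equivSigma n), Nat.card_eq_fintype_card, Fintype.card_sigma]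
  simp [Finsupp.prod]

lemma one_add_tsum_mul_eq_one (k : ℕ) (hk : k ≠ 0) :
    (1 + ∑' j, (2 : ℂ) • (X : ℂ⟦X⟧) ^ (k * (j + 1))) * ((1 - X ^ k) * (1 + X ^ k)⁻¹) = 1 := by
  have hc : constantCoeff (X ^ k : ℂ⟦X⟧) = 0 := by simp [hk]
  have h1 : ∀ j, (2 : ℂ) • (X : ℂ⟦X⟧) ^ (k * (j + 1)) = 2 * X ^ k * (X ^ k) ^ j := by
    intro j
    rw [smul_eq_C_mul, map_ofNat]
    ring
  simp only [h1]
  rw [(WithPiTopology.summable_pow_of_constantCoeff_eq_zero hc).tsum_mul_left]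
  have h2 := WithPiTopology.tsum_pow_mul_one_sub_of_constantCoeff_eq_zero hc
  have h3 := one_add_X_pow_mul_inv k
  linear_combination (2 * X ^ k * (1 + X ^ k)⁻¹) * h2 + h3

/-- The generating function of overpartitions is the inverse of the theta series. -/
theorem thetaSeries_mul_overpartitionSeries : thetaSeries * overpartitionSeries = 1 := by
  apply PowerSeries.map_injective (Int.castRingHom ℂ) Int.cast_injective
  rw [map_mul, map_one, map_overpartitionSeries]
  have h1 := (Nat.Partition.hasProd_genFun fun _ _ => (2 : ℂ)).tendsto_prod_nat
  have h2 := h1.mul tendsto_thetaProd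
  rw [mul_comm]
  refine tendsto_nhds_unique h2 (tendsto_const_nhds.congr fun n => ?_)
  rw [thetaProd, ← prod_mul_distrib]
  exact (prod_eq_one fun i _ => one_add_tsum_mul_eq_one (i + 1) i.succ_ne_zero).symm

/-- Sorting overpartition tuples by the sizes of their components. -/
def OverpartitionTuple.equivSigma (k n : ℕ) : OverpartitionTuple k n ≃
    Σ v : {v : Fin k → ℕ // v ∈ piAntidiag univ n}, ∀ i, Overpartition (v.1 i) where
  toFun ω := ⟨⟨fun i => (ω.1 i).1, mem_piAntidiag.2 ⟨by
    exact (sum_congr rfl fun i _ => (ω.1 i).2.toPartition.parts_sum.symm).trans ω.2,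
    fun i _ => mem_univ i⟩⟩, fun i => (ω.1 i).2⟩
  invFun x := ⟨fun i => ⟨x.1.1 i, x.2 i⟩, by
    exact (sum_congr rfl fun i _ => (x.2 i).toPartition.parts_sum).trans
      (mem_piAntidiag.1 x.1.2).1⟩
  left_inv _ := rfl
  right_inv _ := rfl

/-- The generating function of overpartition `k`-tuples. -/
theorem coeff_overpartitionSeries_pow (k n : ℕ) :
    coeff n (overpartitionSeries ^ k) = overpartitionTupleCount k n := by
  have h : overpartitionSeries ^ k = ∏ _i : Fin k, overpartitionSeries := by simp
  rw [h, coeff_prod, overpartitionTupleCount, Nat.card_congr (OverpartitionTuple.equivSigma k n),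
    Nat.card_sigma, sum_coe_sort (piAntidiag univ n)
      fun v => Nat.card (∀ i, Overpartition (v i)), Nat.cast_sum]
  refine sum_bij (fun l _ => ⇑l) (fun l hl => ?_) (fun _ _ _ _ h => DFunLike.coe_injective h)
    (fun v hv => ⟨Finsupp.equivFunOnFinite.symm v, ?_, rfl⟩) fun l _ => ?_
  · exact mem_piAntidiag.2 ⟨(mem_finsuppAntidiag.1 hl).1, fun i _ => mem_univ i⟩
  · exact mem_finsuppAntidiag.2 ⟨(mem_piAntidiag.1 hv).1, subset_univ _⟩
  · rw [Nat.card_pi, Nat.cast_prod]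
    simp [overpartitionSeries]

/-! ### 3-dissection of the theta series -/

/-- The coefficients of `-thetaSeries / 2` at exponents `3 * k + 1`. -/
noncomputable def thetaOneModThree : ℤ⟦X⟧ :=
  PowerSeries.mk fun k => if IsSquare (3 * k + 1) then (-1) ^ k else 0

lemma not_isSquare_of_mod_three_eq_two {m : ℕ} (h : m % 3 = 2) : ¬ IsSquare m := by
  rintro ⟨k, rfl⟩
  have := Nat.mod_lt k (show 0 < 3 by norm_num)
  rw [Nat.mul_mod] at h
  interval_cases k % 3 <;> omega

lemma isSquare_three_mul_iff (m : ℕ) : IsSquare (3 * m) ↔ ∃ k, m = 3 * k ∧ IsSquare k := by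
  constructor
  · rintro ⟨a, ha⟩
    obtain ⟨b, rfl⟩ : 3 ∣ a := by
      have : 3 ∣ a * a := ⟨m, ha.symm⟩
      exact (Nat.prime_three.dvd_mul.1 this).elim id id
    exact ⟨b * b, by linarith, b, rfl⟩
  · rintro ⟨k, rfl, a, rfl⟩
    exact ⟨3 * a, by ring⟩

/-- The 3-dissection of the theta series. -/
theorem thetaSeries_eq_expand : thetaSeries = expand 3 three_ne_zero (expand 3 three_ne_zero
    thetaSeries) - 2 * X * expand 3 three_ne_zero thetaOneModThree := by
  have h2 : (2 : ℤ⟦X⟧) = C 2 := by simp [map_ofNat]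
  have hodd : ∀ k, (-1 : ℤ) ^ (3 * k) = (-1) ^ k := fun k => by rw [pow_mul]; norm_num
  ext m
  rw [map_sub, mul_assoc, h2, coeff_C_mul]
  obtain ⟨k, rfl | rfl | rfl⟩ : ∃ k, m = 3 * k ∨ m = 3 * k + 1 ∨ m = 3 * k + 2 :=
    ⟨m / 3, by omega⟩
  · have hX : coeff (3 * k) (X * expand 3 three_ne_zero thetaOneModThree) = 0 := by
      rcases k with _ | k
      · simp
      · rw [show 3 * (k + 1) = 3 * k + 2 + 1 by ring, coeff_succ_X_mul,
          coeff_expand_of_not_dvd _ _ _ (by omega)]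
    rw [hX, coeff_expand_mul, mul_zero, sub_zero]
    by_cases h3 : 3 ∣ k
    · obtain ⟨j, rfl⟩ := h3
      rw [coeff_expand_mul, thetaSeries, coeff_mk, coeff_mk]
      have : IsSquare (3 * (3 * j)) ↔ IsSquare j := by
        rw [isSquare_three_mul_iff]
        exact ⟨fun ⟨k, h, hk⟩ => by rwa [show j = k by omega], fun h => ⟨j, rfl, h⟩⟩
      simp [this, hodd]
    · rw [coeff_expand_of_not_dvd _ _ _ h3, thetaSeries, coeff_mk, if_neg (by omega), if_neg]
      rw [isSquare_three_mul_iff]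
      rintro ⟨j, rfl, -⟩
      exact h3 ⟨j, rfl⟩
  · rw [coeff_expand_of_not_dvd _ _ _ (by omega), coeff_succ_X_mul, coeff_expand_mul, thetaSeries,
      thetaOneModThree, coeff_mk, coeff_mk, if_neg (by omega), pow_succ, hodd]
    split_ifs <;> ring
  · rw [coeff_expand_of_not_dvd _ _ _ (by omega), coeff_succ_X_mul,
      coeff_expand_of_not_dvd _ _ _ (by omega), thetaSeries, coeff_mk, if_neg (by omega),
      if_neg (not_isSquare_of_mod_three_eq_two (by omega))]
    simp

/-! ### Norm over cube roots of unity -/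

lemma continuous_expand (p : ℕ) (hp : p ≠ 0) : Continuous (expand p hp : ℂ⟦X⟧ →ₐ[ℂ] ℂ⟦X⟧) := by
  rw [continuous_iff_continuousAt]
  intro f
  rw [ContinuousAt, WithPiTopology.tendsto_iff_coeff_tendsto]
  intro d
  simp only [coeff_expand]
  split_ifs
  · exact (WithPiTopology.continuous_coeff ℂ _).continuousAt
  · exact tendsto_const_nhds

lemma continuous_rescale (c : ℂ) : Continuous (rescale c : ℂ⟦X⟧ →+* ℂ⟦X⟧) := by
  rw [continuous_iff_continuousAt]
  intro f
  rw [ContinuousAt, WithPiTopology.tendsto_iff_coeff_tendsto]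
  intro d
  simp only [coeff_rescale]
  exact (WithPiTopology.continuous_coeff ℂ _).continuousAt.const_mul _

lemma map_one_add_X_pow_inv {i : ℕ} (hi : i ≠ 0) (φ : ℂ⟦X⟧ →+* ℂ⟦X⟧)
    (hφ : constantCoeff (φ X) = 0) : φ (1 + X ^ i)⁻¹ = (1 + φ X ^ i)⁻¹ := by
  rw [PowerSeries.eq_inv_iff_mul_eq_one (by simp [hφ, hi])]
  have := congrArg φ (one_add_X_pow_mul_inv i)
  simpa using this

lemma map_thetaProd (φ : ℂ⟦X⟧ →+* ℂ⟦X⟧) (hφ : constantCoeff (φ X) = 0) (n : ℕ) :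
    φ (thetaProd n) = ∏ i ∈ range n, (1 - φ X ^ (i + 1)) * (1 + φ X ^ (i + 1))⁻¹ := by
  rw [thetaProd, map_prod]
  refine prod_congr rfl fun i _ => ?_
  rw [map_mul, map_one_add_X_pow_inv i.succ_ne_zero φ hφ]
  simp

/-- The factors at the exponents prime to 3 of the norm of the theta product. -/
lemma norm_factor_of_not_dvd {w : ℂ} (hw : w ^ 2 + w + 1 = 0) {i : ℕ} (hi : ¬ 3 ∣ i) (x : ℂ⟦X⟧)
    (hx : constantCoeff x = 0) :
    ((1 - x ^ i) * (1 + x ^ i)⁻¹) * ((1 - (C w * x) ^ i) * (1 + (C w * x) ^ i)⁻¹) *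
      ((1 - (C (w ^ 2) * x) ^ i) * (1 + (C (w ^ 2) * x) ^ i)⁻¹) =
    (1 - (x ^ 3) ^ i) * (1 + (x ^ 3) ^ i)⁻¹ := by
  have hi0 : i ≠ 0 := by rintro rfl; simp at hi
  have hw3 : w ^ 3 = 1 := by linear_combination (w - 1) * hw
  have hv : (w ^ i) ^ 2 + w ^ i + 1 = 0 := by
    obtain ⟨k, rfl | rfl⟩ : ∃ k, i = 3 * k + 1 ∨ i = 3 * k + 2 := ⟨i / 3, by omega⟩
    · simp only [pow_add, pow_mul, hw3, one_pow]; linear_combination hw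
    · simp only [pow_add, pow_mul, hw3, one_pow]; linear_combination (w ^ 2 - w + 1) * hw
  set v := w ^ i
  have hV : (C v : ℂ⟦X⟧) ^ 2 + C v + 1 = 0 := by
    rw [← map_pow, ← map_one C, ← map_add, ← map_add, hv, map_zero]
  have e1 : (C w * x : ℂ⟦X⟧) ^ i = C v * x ^ i := by rw [mul_pow, ← map_pow]
  have e2 : (C (w ^ 2) * x : ℂ⟦X⟧) ^ i = C v ^ 2 * x ^ i := by
    rw [mul_pow, ← map_pow, ← map_pow]; congr 2; ring
  have e3 : (x ^ 3) ^ i = (x ^ i) ^ 3 := by ring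
  rw [e1, e2, e3]
  have h0 : (1 + x ^ i)⁻¹ * (1 + x ^ i) = 1 := PowerSeries.inv_mul_cancel _ (by simp [hx, hi0])
  have h1 : (1 + C v * x ^ i)⁻¹ * (1 + C v * x ^ i) = 1 :=
    PowerSeries.inv_mul_cancel _ (by simp [hx, hi0])
  have h2 : (1 + C v ^ 2 * x ^ i)⁻¹ * (1 + C v ^ 2 * x ^ i) = 1 :=
    PowerSeries.inv_mul_cancel _ (by simp [hx, hi0])
  rw [PowerSeries.eq_mul_inv_iff_mul_eq (by simp [hx, hi0])]
  set y := x ^ i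
  have p1 : 1 + y ^ 3 = (1 + y) * (1 + C v * y) * (1 + C v ^ 2 * y) := by
    linear_combination (-(y + C v * y ^ 2 + (C v - 1) * y ^ 3)) * hV
  have p2 : 1 - y ^ 3 = (1 - y) * (1 - C v * y) * (1 - C v ^ 2 * y) := by
    linear_combination (-(-y + C v * y ^ 2 - (C v - 1) * y ^ 3)) * hV
  rw [p1, p2]
  calc _ = (1 - y) * (1 - C v * y) * (1 - C v ^ 2 * y) * ((1 + y)⁻¹ * (1 + y)) *
      ((1 + C v * y)⁻¹ * (1 + C v * y)) * ((1 + C v ^ 2 * y)⁻¹ * (1 + C v ^ 2 * y)) := by ring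
    _ = _ := by rw [h0, h1, h2]; ring

/-- The norm of a partial product of the theta series, up to third roots of unity. -/
lemma norm_thetaProd {w : ℂ} (hw : w ^ 2 + w + 1 = 0) (n : ℕ) :
    thetaProd (3 * n) * rescale w (thetaProd (3 * n)) * rescale (w ^ 2) (thetaProd (3 * n)) *
      expand 3 three_ne_zero (expand 3 three_ne_zero (thetaProd n)) =
    expand 3 three_ne_zero (thetaProd n) ^ 3 * expand 3 three_ne_zero (thetaProd (3 * n)) := by
  have hw3 : w ^ 3 = 1 := by linear_combination (w - 1) * hw
  have a1 := map_thetaProd (rescale w) (by simp [rescale_X])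
  have a2 := map_thetaProd (rescale (w ^ 2)) (by simp [rescale_X])
  have a3 := map_thetaProd (expand 3 three_ne_zero : ℂ⟦X⟧ →ₐ[ℂ] ℂ⟦X⟧).toRingHom (by simp)
  have a4 := map_thetaProd ((expand 3 three_ne_zero : ℂ⟦X⟧ →ₐ[ℂ] ℂ⟦X⟧).toRingHom.comp
    (expand 3 three_ne_zero : ℂ⟦X⟧ →ₐ[ℂ] ℂ⟦X⟧).toRingHom) (by simp)
  simp only [rescale_X, AlgHom.toRingHom_eq_coe, RingHom.coe_comp, RingHom.coe_coe,
    Function.comp_apply, expand_X] at a1 a2 a3 a4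
  simp only [map_pow, expand_X] at a4
  rw [a1, a2, a4, a3, a3, thetaProd]
  induction n with
  | zero => simp
  | succ n ih =>
    rw [show 3 * (n + 1) = 3 * n + 1 + 1 + 1 by ring]
    simp only [prod_range_succ]
    have f1 := norm_factor_of_not_dvd hw (i := 3 * n + 1) (by omega) X (by simp)
    have f2 := norm_factor_of_not_dvd hw (i := 3 * n + 1 + 1) (by omega) X (by simp)
    -- At multiples of 3 the three conjugate factors coincide, whence the cube on the right.
    have g1 : ∀ c : ℂ, c ^ 3 = 1 → (C c * X : ℂ⟦X⟧) ^ (3 * n + 1 + 1 + 1) = (X ^ 3) ^ (n + 1) := by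
      intro c hc
      rw [show 3 * n + 1 + 1 + 1 = 3 * (n + 1) by ring, pow_mul, mul_pow, ← map_pow, hc, map_one,
        one_mul]
    have g2 : (X : ℂ⟦X⟧) ^ (3 * n + 1 + 1 + 1) = (X ^ 3) ^ (n + 1) := by
      rw [← pow_mul]; congr 1
    have g3 : ((X : ℂ⟦X⟧) ^ 3) ^ (3 * n + 1 + 1 + 1) = ((X ^ 3) ^ 3) ^ (n + 1) := by
      rw [← pow_mul, ← pow_mul, ← pow_mul]; congr 1
    rw [g1 w hw3, g1 (w ^ 2) (by rw [← pow_mul, mul_comm, pow_mul, hw3, one_pow]), g2, g3,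
      ← f1, ← f2]
    generalize (1 - (X ^ 3) ^ (n + 1)) * (1 + (X ^ 3) ^ (n + 1) : ℂ⟦X⟧)⁻¹ = u
    generalize (1 - ((X ^ 3) ^ 3) ^ (n + 1)) * (1 + ((X ^ 3) ^ 3) ^ (n + 1) : ℂ⟦X⟧)⁻¹ = v
    generalize (1 - X ^ (3 * n + 1)) * (1 + X ^ (3 * n + 1) : ℂ⟦X⟧)⁻¹ = b₀
    generalize (1 - X ^ (3 * n + 1 + 1)) * (1 + X ^ (3 * n + 1 + 1) : ℂ⟦X⟧)⁻¹ = c₀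
    generalize (1 - (C w * X) ^ (3 * n + 1)) * (1 + (C w * X) ^ (3 * n + 1) : ℂ⟦X⟧)⁻¹ = b₁
    generalize (1 - (C w * X) ^ (3 * n + 1 + 1)) * (1 + (C w * X) ^ (3 * n + 1 + 1) : ℂ⟦X⟧)⁻¹ = c₁
    generalize (1 - (C (w ^ 2) * X) ^ (3 * n + 1)) *
      (1 + (C (w ^ 2) * X) ^ (3 * n + 1) : ℂ⟦X⟧)⁻¹ = b₂
    generalize (1 - (C (w ^ 2) * X) ^ (3 * n + 1 + 1)) *
      (1 + (C (w ^ 2) * X) ^ (3 * n + 1 + 1) : ℂ⟦X⟧)⁻¹ = c₂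
    linear_combination (u ^ 3 * v * b₀ * b₁ * b₂ * c₀ * c₁ * c₂) * ih

lemma rescale_expand_three {w : ℂ} (hw : w ^ 3 = 1) (f : ℂ⟦X⟧) :
    rescale w (expand 3 three_ne_zero f) = expand 3 three_ne_zero f := by
  ext m
  rw [coeff_rescale, coeff_expand]
  split_ifs with h
  · obtain ⟨k, rfl⟩ := h
    rw [pow_mul, hw, one_pow, one_mul]
  · rw [mul_zero]

/-- The norm of the theta series over third roots of unity, in terms of its 3-dissection. -/
theorem thetaSeries_pow_four : thetaSeries ^ 4 = expand 3 three_ne_zero thetaSeries *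
    (expand 3 three_ne_zero thetaSeries ^ 3 - 8 * X * thetaOneModThree ^ 3) := by
  apply PowerSeries.map_injective (Int.castRingHom ℂ) Int.cast_injective
  obtain ⟨w, hw⟩ : ∃ w : ℂ, w ^ 2 + w + 1 = 0 := by
    obtain ⟨w, hw⟩ := IsAlgClosed.exists_root (Polynomial.X ^ 2 + Polynomial.X + 1 : Polynomial ℂ)
      (by rw [show (Polynomial.X ^ 2 + Polynomial.X + 1 : Polynomial ℂ).degree = 2 by
        compute_degree!]; norm_num)
    exact ⟨w, by simpa [Polynomial.IsRoot] using hw⟩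
  have hw3 : w ^ 3 = 1 := by linear_combination (w - 1) * hw
  have hW : (C w : ℂ⟦X⟧) ^ 2 + C w + 1 = 0 := by
    rw [← map_pow, ← map_one C, ← map_add, ← map_add, hw, map_zero]
  have hd := congrArg (PowerSeries.map (Int.castRingHom ℂ)) thetaSeries_eq_expand
  simp only [map_sub, map_mul, map_X, map_expand, map_ofNat, map_pow] at hd ⊢
  have h3 : Tendsto (fun n => 3 * n) atTop atTop :=
    tendsto_id.const_mul_atTop' (by norm_num : 0 < 3)
  have t1 := tendsto_thetaProd
  have t3 := t1.comp h3
  have t2 := ((continuous_expand 3 three_ne_zero).tendsto _).comp t1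
  have t4 := ((continuous_expand 3 three_ne_zero).tendsto _).comp t2
  have L := ((t3.mul (((continuous_rescale w).tendsto _).comp t3)).mul
    (((continuous_rescale (w ^ 2)).tendsto _).comp t3)).mul t4
  have R := (t2.pow 3).mul (((continuous_expand 3 three_ne_zero).tendsto _).comp t3)
  have key := tendsto_nhds_unique L (R.congr fun n => (norm_thetaProd hw n).symm)
  set f := PowerSeries.map (Int.castRingHom ℂ) thetaSeries
  set b := PowerSeries.map (Int.castRingHom ℂ) thetaOneModThree
  have r : ∀ c : ℂ, c ^ 3 = 1 → rescale c f = expand 3 three_ne_zero (expand 3 three_ne_zero f) -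
      2 * (C c * X) * expand 3 three_ne_zero b := by
    intro c hc
    conv_lhs => rw [hd]
    simp [rescale_expand_three hc, rescale_X, map_ofNat]
  rw [r w hw3, r (w ^ 2) (by rw [← pow_mul, mul_comm, pow_mul, hw3, one_pow])] at key
  -- The limit identity is the image of the goal under `q ↦ q^3`.
  have hinj : Function.Injective (expand 3 three_ne_zero : ℂ⟦X⟧ →ₐ[ℂ] ℂ⟦X⟧) := by
    intro p q h
    ext m
    rw [← coeff_expand_mul 3 three_ne_zero p, h, coeff_expand_mul]
  apply hinj
  simp only [map_sub, map_mul, map_pow, expand_X, map_ofNat]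
  rw [map_pow] at key
  set A := expand 3 three_ne_zero (expand 3 three_ne_zero f)
  set B := expand 3 three_ne_zero b
  linear_combination -key + (A - 2 * (C w * X) * B) * (A - 2 * (C w ^ 2 * X) * B) * A * hd +
    A * (A - 2 * X * B) * (-(2 * X * A * B) + 4 * X ^ 2 * B ^ 2 * (C w - 1)) * hW

/-! ### Extraction of exponents divisible by 3, modulo 9 -/

section Trisection
variable {R : Type*} [CommRing R] (a b c : R⟦X⟧) (n : ℕ)

lemma coeff_three_mul_trisection : coeff (3 * n) (expand 3 three_ne_zero a +
    X * expand 3 three_ne_zero b + X ^ 2 * expand 3 three_ne_zero c) = coeff n a := by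
  rw [map_add, map_add, coeff_expand_mul]
  rcases n with _ | n
  · simp
  · rw [show 3 * (n + 1) = 3 * n + 2 + 1 by ring, coeff_succ_X_mul, pow_succ, mul_assoc, pow_one,
      coeff_succ_X_mul, coeff_succ_X_mul, coeff_expand_of_not_dvd _ _ _ (by omega),
      coeff_expand_of_not_dvd _ _ _ (by omega), add_zero, add_zero]

lemma coeff_three_mul_add_two_trisection : coeff (3 * n + 2) (expand 3 three_ne_zero a +
    X * expand 3 three_ne_zero b) = 0 := by
  rw [map_add, coeff_succ_X_mul, coeff_expand_of_not_dvd _ _ _ (by omega),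
      coeff_expand_of_not_dvd _ _ _ (by omega), add_zero]

end Trisection

lemma natCast_dvd_iff_map_eq_zero (n : ℕ) (F : ℤ⟦X⟧) :
    (n : ℤ⟦X⟧) ∣ F ↔ PowerSeries.map (Int.castRingHom (ZMod n)) F = 0 := by
  constructor
  · rintro ⟨G, rfl⟩
    rw [map_mul, map_natCast, ← map_natCast C, ZMod.natCast_self, map_zero, zero_mul]
  · intro h
    refine ⟨PowerSeries.mk fun k => coeff k F / n, PowerSeries.ext fun k => ?_⟩
    rw [← map_natCast C, coeff_C_mul, coeff_mk, Int.mul_ediv_cancel']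
    rw [← ZMod.intCast_zmod_eq_zero_iff_dvd]
    simpa using congrArg (coeff k) h

lemma natCast_dvd_expand_sub_pow (p : ℕ) [hp : Fact p.Prime] (F : ℤ⟦X⟧) :
    (p : ℤ⟦X⟧) ∣ expand p hp.out.ne_zero F - F ^ p := by
  rw [natCast_dvd_iff_map_eq_zero, map_sub, map_expand, map_pow, sub_eq_zero]
  have h := MvPowerSeries.map_frobenius_expand (p := p) hp.out.ne_zero
    (f := PowerSeries.map (Int.castRingHom (ZMod p)) F)
  rw [ZMod.frobenius_zmod, MvPowerSeries.map_id] at h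
  exact h

/-- Cubing a congruence modulo 3 lifts it to modulo 9. -/
lemma thetaSeries_pow_nine_modEq :
    (9 : ℤ⟦X⟧) ∣ expand 3 three_ne_zero thetaSeries ^ 3 - thetaSeries ^ 9 := by
  have := dvd_sub_pow_of_dvd_sub (natCast_dvd_expand_sub_pow 3 thetaSeries) 1
  convert this using 1
  · norm_num
  · ring

section ModNine
variable {R : Type*} [CommRing R] {f h w : R⟦X⟧}

local notation "E" => expand 3 three_ne_zero

/-- The 3-dissection of the inverse of a series with a theta-like dissection. -/
lemma eq_mul_expand_of_dissection (hfh : f * h = 1) (hd : f = E (E f) - 2 * X * E w)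
    (hN : f ^ 4 = E f * (E f ^ 3 - 8 * X * w ^ 3)) :
    h = (E (E f) ^ 2 + 2 * X * E (E f) * E w + 4 * X ^ 2 * E w ^ 2) * E (E f * h ^ 4) := by
  have hK : E (E f * h ^ 4) * (E (E f) ^ 3 - 8 * X ^ 3 * E w ^ 3) = 1 := by
    have h1 : E f * h ^ 4 * (E f ^ 3 - 8 * X * w ^ 3) = 1 := by
      calc _ = (f * h) ^ 4 := by rw [mul_pow, hN]; ring
        _ = 1 := by rw [hfh, one_pow]
    have h2 := congrArg E h1
    simp only [map_mul, map_sub, map_pow, expand_X, map_ofNat, map_one] at h2 ⊢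
    exact h2
  generalize E (E f * h ^ 4) = K at *
  linear_combination (-h) * hK - (E (E f) ^ 2 + 2 * X * E (E f) * E w + 4 * X ^ 2 * E w ^ 2) * K *
    (h * hd - hfh)

lemma coeff_three_mul_inv_pow_three (h9 : (9 : R⟦X⟧) = 0) (hfh : f * h = 1)
    (hd : f = E (E f) - 2 * X * E w) (hN : f ^ 4 = E f * (E f ^ 3 - 8 * X * w ^ 3)) (n : ℕ) :
    coeff (3 * n) (h ^ 3) = coeff n (E f * h ^ 4) := by
  have hh := eq_mul_expand_of_dissection hfh hd hN
  -- With `t = 2Xw`, the cube of `a^2 + at + t^2` has trisection component `a^6 + 7a^3t^3 + t^6`,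
  -- which is `(a^3 - t^3)^2` modulo 9.
  have e : (E f * h ^ 4) ^ 3 * (E f ^ 6 + 56 * E f ^ 3 * w ^ 3 * X + 64 * w ^ 6 * X ^ 2) =
      E f * h ^ 4 := by
    calc _ = (E f * h ^ 4) ^ 3 * ((E f ^ 3 - 8 * X * w ^ 3) ^ 2 +
          9 * (E f ^ 6 - E f ^ 3 * (E f ^ 3 - 8 * X * w ^ 3))) := by ring
      _ = E f * h ^ 12 * (E f * (E f ^ 3 - 8 * X * w ^ 3)) ^ 2 := by rw [h9]; ring
      _ = E f * h ^ 4 * (f * h) ^ 8 := by rw [← hN]; ring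
      _ = _ := by rw [hfh, one_pow, mul_one]
  have key : h ^ 3 = E (E f * h ^ 4) +
      X * E ((E f * h ^ 4) ^ 3 * (6 * E f ^ 5 * w + 96 * E f ^ 2 * w ^ 4 * X)) +
      X ^ 2 * E ((E f * h ^ 4) ^ 3 * (24 * E f ^ 4 * w ^ 2 + 96 * E f * w ^ 5 * X)) := by
    rw [← congrArg E e]
    conv_lhs => rw [hh]
    rw [map_mul E (_ ^ 3), map_mul E (_ ^ 3), map_mul E (_ ^ 3), map_pow E (E f * h ^ 4)]
    generalize E (E f * h ^ 4) = K
    simp only [map_mul, map_add, map_pow, expand_X, map_ofNat]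
    ring
  rw [key, coeff_three_mul_trisection]

lemma coeff_three_mul_expand_mul_inv_pow_four (h9 : (9 : R⟦X⟧) = 0) (hfh : f * h = 1)
    (hd : f = E (E f) - 2 * X * E w) (hN : f ^ 4 = E f * (E f ^ 3 - 8 * X * w ^ 3))
    (hf9 : E f ^ 3 = f ^ 9) (n : ℕ) :
    coeff (3 * n) (E f * h ^ 4) = coeff n (E f * f ^ 2) := by
  have hh := eq_mul_expand_of_dissection hfh hd hN
  -- For the fourth power the component is `a^8 + 16a^5t^3 + 10a^2t^6`, which is `a^2 (a^3 - t^3)^2`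
  -- modulo 9.
  have e : f * (E f * h ^ 4) ^ 4 * (E f ^ 8 + 128 * E f ^ 5 * w ^ 3 * X +
      640 * E f ^ 2 * w ^ 6 * X ^ 2) = E f * f ^ 2 := by
    calc _ = f * (E f * h ^ 4) ^ 4 * E f ^ 2 * ((E f ^ 3 - 8 * X * w ^ 3) ^ 2 +
          9 * (3 * E f ^ 6 - 4 * E f ^ 3 * (E f ^ 3 - 8 * X * w ^ 3) +
            (E f ^ 3 - 8 * X * w ^ 3) ^ 2)) := by ring
      _ = f * E f * E f ^ 3 * h ^ 16 * (E f * (E f ^ 3 - 8 * X * w ^ 3)) ^ 2 := by rw [h9]; ring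
      _ = E f * f ^ 2 * (f * h) ^ 16 := by rw [← hN, hf9]; ring
      _ = _ := by rw [hfh, one_pow, mul_one]
  have key : E f * h ^ 4 = E (E f * f ^ 2) +
      X * E (f * (E f * h ^ 4) ^ 4 *
        (8 * E f ^ 7 * w + 304 * E f ^ 4 * w ^ 4 * X + 512 * E f * w ^ 7 * X ^ 2)) +
      X ^ 2 * E (f * (E f * h ^ 4) ^ 4 *
        (40 * E f ^ 6 * w ^ 2 + 512 * E f ^ 3 * w ^ 5 * X + 256 * w ^ 8 * X ^ 2)) := by
    rw [← e]
    conv_lhs => rw [hh]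
    rw [map_mul E (_ * _ ^ 4), map_mul E (_ * _ ^ 4), map_mul E (_ * _ ^ 4), map_mul E f,
      map_pow E (E f * h ^ 4)]
    generalize E (E f * h ^ 4) = K
    simp only [map_mul, map_add, map_pow, expand_X, map_ofNat]
    ring
  rw [key, coeff_three_mul_trisection]

lemma coeff_three_mul_expand_mul_sq (hd : f = E (E f) - 2 * X * E w) (n : ℕ) :
    coeff (3 * n) (E f * f ^ 2) = coeff n (f * E f ^ 2) := by
  have key : E f * f ^ 2 = E (f * E f ^ 2) + X * E (f * (-4 * E f * w)) +
      X ^ 2 * E (f * (4 * w ^ 2)) := by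
    nth_rewrite 2 [hd]
    simp only [map_mul, map_pow, map_neg, map_ofNat]
    ring
  rw [key, coeff_three_mul_trisection]

/-- The absence of an `X ^ 2` component, inherited from `f`, is what finally kills the coefficients
at `3n+2`. -/
lemma mul_expand_sq_eq_of_dissection (hd : f = E (E f) - 2 * X * E w) :
    f * E f ^ 2 = E (E f * f ^ 2) + X * E (-2 * w * f ^ 2) := by
  nth_rewrite 1 [hd]
  simp only [map_mul, map_pow, map_neg, map_ofNat]
  ring

lemma coeff_three_mul_mul_expand_sq (hd : f = E (E f) - 2 * X * E w) (n : ℕ) :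
    coeff (3 * n) (f * E f ^ 2) = coeff n (E f * f ^ 2) := by
  have := coeff_three_mul_trisection (E f * f ^ 2) (-2 * w * f ^ 2) 0 n
  rwa [map_zero, mul_zero, add_zero, ← mul_expand_sq_eq_of_dissection hd] at this

lemma coeff_three_pow_mul_inv_pow_three (h9 : (9 : R⟦X⟧) = 0) (hfh : f * h = 1)
    (hd : f = E (E f) - 2 * X * E w) (hN : f ^ 4 = E f * (E f ^ 3 - 8 * X * w ^ 3))
    (hf9 : E f ^ 3 = f ^ 9) {k : ℕ} (hk : 1 ≤ k) (n : ℕ) :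
    coeff (3 ^ (2 * k + 1) * n) (h ^ 3) = coeff n (f * E f ^ 2) := by
  induction k, hk using Nat.le_induction generalizing n with
  | base =>
    rw [show 3 ^ (2 * 1 + 1) * n = 3 * (3 * (3 * n)) by ring,
      coeff_three_mul_inv_pow_three h9 hfh hd hN,
      coeff_three_mul_expand_mul_inv_pow_four h9 hfh hd hN hf9, coeff_three_mul_expand_mul_sq hd]
  | succ k _ ih =>
    rw [show 3 ^ (2 * (k + 1) + 1) * n = 3 ^ (2 * k + 1) * (3 * (3 * n)) by ring, ih,
      coeff_three_mul_mul_expand_sq hd, coeff_three_mul_expand_mul_sq hd]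

end ModNine

theorem nine_dvd_coeff_overpartitionSeries_pow_three {α : ℕ} (hα : 1 ≤ α) (n : ℕ) :
    (9 : ℤ) ∣ coeff (3 ^ (2 * α + 1) * (3 * n + 2)) (overpartitionSeries ^ 3) := by
  set φ := PowerSeries.map (Int.castRingHom (ZMod 9))
  have h9 : (9 : (ZMod 9)⟦X⟧) = 0 := by
    rw [← map_ofNat C, show (OfNat.ofNat 9 : ZMod 9) = 0 from rfl, map_zero]
  have hfh := congrArg φ thetaSeries_mul_overpartitionSeries
  have hd := congrArg φ thetaSeries_eq_expand
  have hN := congrArg φ thetaSeries_pow_four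
  have hf9 := (natCast_dvd_iff_map_eq_zero 9 _).1 thetaSeries_pow_nine_modEq
  simp only [φ, map_sub, map_mul, map_X, map_expand, map_ofNat, map_pow, map_one] at hfh hd hN hf9
  have h := coeff_three_pow_mul_inv_pow_three h9 hfh hd hN (sub_eq_zero.1 hf9) hα (3 * n + 2)
  rw [mul_expand_sq_eq_of_dissection hd, coeff_three_mul_add_two_trisection, ← map_pow,
    coeff_map] at h
  exact (ZMod.intCast_zmod_eq_zero_iff_dvd _ 9).1 h

/-! ### Divisibility by 16 -/

/-- The series `∑ (-1)^n X^(n^2)` over positive integers `n`. -/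
noncomputable def halfThetaSeries : ℤ⟦X⟧ :=
  PowerSeries.mk fun m => if m ≠ 0 ∧ IsSquare m then (-1) ^ m else 0

lemma thetaSeries_eq_one_add : thetaSeries = 1 + 2 * halfThetaSeries := by
  have h2 : (2 : ℤ⟦X⟧) = C 2 := by simp [map_ofNat]
  ext m
  rw [map_add, h2, coeff_C_mul, thetaSeries, halfThetaSeries, coeff_mk, coeff_mk, coeff_one]
  split_ifs <;> simp_all

lemma coeff_halfThetaSeries_of_not_isSquare {m : ℕ} (h : ¬ IsSquare m) :
    coeff m halfThetaSeries = 0 := by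
  rw [halfThetaSeries, coeff_mk, if_neg fun h' => h h'.2]

lemma overpartitionSeries_pow_three_modEq : (16 : ℤ⟦X⟧) ∣ overpartitionSeries ^ 3 -
    (1 - 6 * halfThetaSeries + 8 * expand 2 two_ne_zero halfThetaSeries) := by
  obtain ⟨T, hT⟩ := natCast_dvd_expand_sub_pow 2 halfThetaSeries
  have h := thetaSeries_mul_overpartitionSeries
  rw [thetaSeries_eq_one_add] at h
  have h3 : (1 + 2 * halfThetaSeries) ^ 3 * overpartitionSeries ^ 3 = 1 := by
    rw [← mul_pow, h, one_pow]
  set S := halfThetaSeries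
  rw [Nat.cast_ofNat] at hT
  -- From `(1 + 2S)^3 (1 - 6S + 8S^2) = 1 + 16 S^2 (-1 - S + 3S^2 + 4S^3)`; `T` accounts for
  -- replacing `S^2` by `S(q^2)` modulo 2.
  refine ⟨-T - overpartitionSeries ^ 3 * S ^ 2 * (-1 - S + 3 * S ^ 2 + 4 * S ^ 3), ?_⟩
  linear_combination (1 - 6 * S + 8 * S ^ 2) * h3 - 8 * hT

/-- A square has even 3-adic valuation. -/
lemma three_dvd_of_isSquare (α : ℕ) {t : ℕ} (h : IsSquare (3 ^ (2 * α + 1) * t)) : 3 ∣ t := by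
  induction α with
  | zero =>
    obtain ⟨k, hk, -⟩ := (isSquare_three_mul_iff t).1 (by simpa using h)
    exact ⟨k, hk⟩
  | succ α ih =>
    rw [show 3 ^ (2 * (α + 1) + 1) * t = 3 * (3 * (3 ^ (2 * α + 1) * t)) by ring] at h
    obtain ⟨k, hk, hs⟩ := (isSquare_three_mul_iff _).1 h
    exact ih (by rwa [Nat.eq_of_mul_eq_mul_left three_pos hk])

theorem sixteen_dvd_coeff_overpartitionSeries_pow_three (α n : ℕ) :
    (16 : ℤ) ∣ coeff (3 ^ (2 * α + 1) * (3 * n + 2)) (overpartitionSeries ^ 3) := by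
  obtain ⟨T, hT⟩ := overpartitionSeries_pow_three_modEq
  have hC : ∀ (c : ℕ) [c.AtLeastTwo] (m : ℕ) (F : ℤ⟦X⟧),
      coeff m (OfNat.ofNat c * F) = OfNat.ofNat c * coeff m F := by
    intro c _ m F
    rw [← map_ofNat C, coeff_C_mul]
  refine ⟨coeff (3 ^ (2 * α + 1) * (3 * n + 2)) T, ?_⟩
  rw [sub_eq_iff_eq_add.1 hT, map_add, map_add, map_sub, hC, hC, hC,
    coeff_halfThetaSeries_of_not_isSquare fun h => ?_, coeff_one, if_neg (by positivity),
    coeff_expand]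
  · split_ifs with h2
    -- Half of `3n+2` is still prime to 3, so half the exponent is not a square.
    · obtain ⟨t, ht⟩ : 2 ∣ 3 * n + 2 :=
        (Nat.Coprime.pow_right _ (by norm_num)).dvd_of_dvd_mul_left h2
      rw [ht, mul_left_comm, Nat.mul_div_cancel_left _ two_pos,
        coeff_halfThetaSeries_of_not_isSquare fun h => ?_]
      · simp
      · have := three_dvd_of_isSquare α h
        omega
    · simp
  · have := three_dvd_of_isSquare α h
    omega

theorem mainTheorem1 (α n : ℕ) (hα : 1 ≤ α) :
    overpartitionTupleCount 3 (3 ^ (2 * α + 1) * (3 * n + 2)) ≡ 0 [MOD 144] := by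
  rw [Nat.modEq_zero_iff_dvd, ← Int.natCast_dvd_natCast, ← coeff_overpartitionSeries_pow]
  exact IsCoprime.mul_dvd (x := (16 : ℤ)) (y := 9) (by norm_num)
    (sixteen_dvd_coeff_overpartitionSeries_pow_three α n)
    (nine_dvd_coeff_overpartitionSeries_pow_three hα n)
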